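/- For a real number $x$ and an integer $k \ge 1$ let $\pi_{2k}(x)$ denote the number of primes $p \le x$ such that $p+2k$ is also prime. Let $C > 1/2$ be a constant, and let $E = E(x)$ be a real-valued function such that $C\log x \le E(x)$ for all sufficiently large $x$ and $E(x) = o(x/\log^2 x)$ as $x \to \infty$. Then $$\frac{1}{\lfloor E\rfloor^2}\sum_{1\le k\le E}(\lfloor E\rfloor-k)\,\pi_{2k}(x)\;\ge\;\Bigl(1-\frac{1}{2C}\Bigr)\frac{x}{\log^2 x}\,(1+o(1)) \qquad (x\to\infty),$$ meaning that for every $\epsilon>0$ there is $x_\epsilon$ such that for all real $x\ge x_\epsilon$ the left-hand side is at least $(1-\epsilon)\bigl(1-\frac{1}{2C}\bigr)\frac{x}{\log^2 x}$. -/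

import Mathlib

open Filter Asymptotics

/-- `primePairCount h x` is the number `π_h(x)` of primes `p ≤ x` such that `p + h` is also prime. -/
noncomputable def primePairCount (h : ℕ) (x : ℝ) : ℕ :=
  (Finset.filter (fun p : ℕ => p.Prime ∧ (p + h).Prime) (Finset.Iic ⌊x⌋₊)).card

/-- The relation `f(x) ≥ g(x) (1 + o(1))` as `x → ∞`: for every `ε > 0` one has
`f(x) ≥ (1 - ε) g(x)` for all sufficiently large `x`. -/
def AsympGE (f g : ℝ → ℝ) : Prop :=
  ∀ ε : ℝ, 0 < ε → ∀ᶠ x : ℝ in atTop, (1 - ε) * g x ≤ f x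

/-! Slide a window of `K = ⌊E⌋` consecutive odd numbers along `[1, x]`. There are about `x/2 + K`
windows and each of the `N ≈ π(x)` odd primes lies in `K` of them, so by Cauchy–Schwarz the squared
window counts sum to at least `(K N)² / (x/2 + K)`. Expanding the squares, a pair of primes at
distance `2k` shares `K - k` windows, so the same sum is at most `K N + 2S`, with `S = ∑ (K - k)
π_{2k}(x)`. Hence `S / K²` is at least about `N (N / x - 1 / (2K))`. With `N ~ x / log x`, `K ≥ C
log x (1 + o(1))` and `K = o(x)` this is the claim; using odd numbers only is what makes the loss
`1/(2C)` instead of `1/C`. The inequality is `sq_primeCounting_le_sum_primePairCount`.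

Only a lower bound for `π(x)` is needed, because the bound increases with `N` where the bracket is
nonnegative. That half of the prime number theorem is proved in Wiener–Ikehara style: `a(t) = ψ(e^t)
e^{-t}` is bounded, and the Laplace transform of `a - 1` extends continuously to `0 ≤ re s`, so the
Fejér means of `a - 1` vanish at infinity. Since `a(t) e^t` is monotone, a value of `a` well below 1
would keep `a` small just to its left and pull a mean below its limit. -/

open MeasureTheory
open scoped Topology

/-! ### Second moment of window counts -/

/-- Each element of `A` lies in exactly `K` of the windows of length `K`. -/
lemma sum_card_window (A : Finset ℕ) {M : ℕ} (K : ℕ) (hA : ∀ m ∈ A, m < M) :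
    ∑ j ∈ Finset.range (M + K), (A.filter fun m => m ≤ j ∧ j < m + K).card = K * A.card := by
  simp only [Finset.card_filter]
  rw [Finset.sum_comm]
  have : ∀ m ∈ A, ∑ j ∈ Finset.range (M + K), (if m ≤ j ∧ j < m + K then 1 else 0) = K := by
    intro m hm
    rw [← Finset.card_filter]
    have : (Finset.range (M + K)).filter (fun j => m ≤ j ∧ j < m + K) = Finset.Ico m (m + K) := by
      ext j
      have := hA m hm
      simp only [Finset.mem_filter, Finset.mem_range, Finset.mem_Ico]
      omega
    rw [this]
    simp
  rw [Finset.sum_congr rfl this]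
  simp [mul_comm]

/-- The square counts ordered pairs in a common window. The truncated differences add up to `|m -
m'|`, and two points share `K - |m - m'|` windows, or none. -/
lemma sum_card_window_sq (A : Finset ℕ) {M : ℕ} (K : ℕ) (hA : ∀ m ∈ A, m < M) :
    ∑ j ∈ Finset.range (M + K), (A.filter fun m => m ≤ j ∧ j < m + K).card ^ 2 =
      ∑ m ∈ A, ∑ m' ∈ A, (K - (m - m' + (m' - m))) := by
  have h1 : ∀ j, (A.filter fun m => m ≤ j ∧ j < m + K).card ^ 2 =
      ∑ m ∈ A, ∑ m' ∈ A, if (m ≤ j ∧ j < m + K) ∧ (m' ≤ j ∧ j < m' + K) then 1 else 0 := by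
    intro j
    rw [sq, Finset.card_filter, Finset.sum_mul_sum]
    refine Finset.sum_congr rfl fun m _ => Finset.sum_congr rfl fun m' _ => ?_
    split_ifs <;> simp_all
  rw [Finset.sum_congr rfl fun j _ => h1 j, Finset.sum_comm]
  refine Finset.sum_congr rfl fun m hm => ?_
  rw [Finset.sum_comm]
  refine Finset.sum_congr rfl fun m' hm' => ?_
  rw [← Finset.card_filter]
  have : (Finset.range (M + K)).filter
      (fun j => (m ≤ j ∧ j < m + K) ∧ (m' ≤ j ∧ j < m' + K)) =
      Finset.Ico (max m m') (min m m' + K) := by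
    ext j
    have := hA m hm
    have := hA m' hm'
    simp only [Finset.mem_filter, Finset.mem_range, Finset.mem_Ico]
    omega
  rw [this, Nat.card_Ico]
  omega

lemma sum_sub_dist_eq (A : Finset ℕ) (K : ℕ) :
    ∑ m ∈ A, ∑ m' ∈ A, (K - (m - m' + (m' - m))) =
      K * A.card + 2 * ∑ k ∈ Finset.Icc 1 K, (K - k) * (A.filter fun m => m + k ∈ A).card := by
  have h0 : ∀ m ∈ A, ∀ m' ∈ A, (K - (m - m' + (m' - m))) =
      (if m' = m then K else 0) + ((if m < m' then K - (m' - m) else 0) +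
        (if m' < m then K - (m - m') else 0)) := by
    intro m _ m' _
    split_ifs <;> omega
  have h1 : ∑ m ∈ A, ∑ m' ∈ A, (if m < m' then K - (m' - m) else 0) =
      ∑ k ∈ Finset.Icc 1 K, (K - k) * (A.filter fun m => m + k ∈ A).card := by
    have h2 : ∀ k, (K - k) * (A.filter fun m => m + k ∈ A).card =
        ∑ m ∈ A, if m + k ∈ A then K - k else 0 := by
      intro k
      rw [Finset.card_filter, Finset.mul_sum]
      simp
    simp only [h2]
    rw [Finset.sum_comm (s := Finset.Icc 1 K)]
    refine Finset.sum_congr rfl fun m _ => ?_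
    rw [← Finset.sum_filter, ← Finset.sum_filter]
    -- Pairs further apart than `K` contribute zero by truncated subtraction.
    have h3 : ∑ m' ∈ A.filter (fun m' => m < m' ∧ m' - m ≤ K), (K - (m' - m)) =
        ∑ m' ∈ A.filter (fun m' => m < m'), (K - (m' - m)) := by
      apply Finset.sum_subset
      · intro m'; simp only [Finset.mem_filter]; tauto
      · intro m'; simp only [Finset.mem_filter]; intro h h'
        have : ¬ (m' - m ≤ K) := fun h4 => h' ⟨h.1, h.2, h4⟩
        omega
    rw [← h3]
    refine Finset.sum_nbij' (fun m' => m' - m) (fun k => m + k) ?_ ?_ ?_ ?_ ?_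
    · intro m'; simp only [Finset.mem_filter, Finset.mem_Icc]; rintro ⟨h, h', h''⟩
      rw [Nat.add_sub_cancel' h'.le]
      exact ⟨⟨by omega, by omega⟩, h⟩
    · intro k; simp only [Finset.mem_filter, Finset.mem_Icc]; rintro ⟨h, h'⟩
      exact ⟨h', by omega, by omega⟩
    · intro m'; simp only [Finset.mem_filter]; omega
    · intro k; simp
    · intro k; simp
  have h2 : ∑ m ∈ A, ∑ m' ∈ A, (if m' < m then K - (m - m') else 0) =
      ∑ m ∈ A, ∑ m' ∈ A, (if m < m' then K - (m' - m) else 0) := Finset.sum_comm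
  rw [Finset.sum_congr rfl fun m hm => Finset.sum_congr rfl fun m' hm' => h0 m hm m' hm']
  simp only [Finset.sum_add_distrib]
  rw [h2, h1]
  have : ∑ m ∈ A, ∑ m' ∈ A, (if m' = m then K else 0) = K * A.card := by
    simp [mul_comm]
  rw [this]; ring

/-- Cauchy--Schwarz over the windows of length `K`. -/
lemma sq_card_le_sum_card_pairs (A : Finset ℕ) {M : ℕ} (K : ℕ) (hA : ∀ m ∈ A, m < M) :
    (K * A.card) ^ 2 ≤ (M + K) * (K * A.card +
      2 * ∑ k ∈ Finset.Icc 1 K, (K - k) * (A.filter fun m => m + k ∈ A).card) := by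
  rw [← sum_sub_dist_eq, ← sum_card_window_sq A K hA, ← sum_card_window A K hA]
  simpa using sq_sum_le_card_mul_sum_sq (s := Finset.range (M + K))
    (f := fun j => (A.filter fun m => m ≤ j ∧ j < m + K).card)

/-! ### Window bound for odd primes -/

/-- The summand 1 is the prime 2. Coding an odd prime as `2 * m + 1` halves distances, so a gap `k`
in `m` is a prime gap `2 * k`. -/
lemma primeCounting_eq_card_odd_add_one {N : ℕ} (hN : 2 ≤ N) :
    Nat.primeCounting N =
      ((Finset.range ((N + 1) / 2)).filter fun m => (2 * m + 1).Prime).card + 1 := by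
  have h : (Finset.range (N + 1)).filter Nat.Prime =
      insert 2 (((Finset.range ((N + 1) / 2)).filter fun m => (2 * m + 1).Prime).image
        fun m => 2 * m + 1) := by
    ext p
    simp only [Finset.mem_filter, Finset.mem_range, Finset.mem_insert, Finset.mem_image]
    constructor
    · rintro ⟨h1, h2⟩
      rcases h2.eq_two_or_odd' with h | ⟨m, rfl⟩
      · exact Or.inl h
      · exact Or.inr ⟨m, ⟨by omega, h2⟩, rfl⟩
    · rintro (rfl | ⟨m, ⟨h1, h2⟩, rfl⟩)
      · exact ⟨by omega, Nat.prime_two⟩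
      · exact ⟨by omega, h2⟩
  rw [Nat.primeCounting, Nat.primeCounting', Nat.count_eq_card_filter_range, h,
    Finset.card_insert_of_notMem, Finset.card_image_of_injective]
  · intro a b; simp
  · simp only [Finset.mem_image, not_exists]; intro a; omega

/-- The window bound for prime pairs: the odd primes `p ≤ x` are counted in windows of `K`
consecutive odd numbers. -/
lemma sq_primeCounting_le_sum_primePairCount {x : ℝ} (hx : 2 ≤ x) (K : ℕ) :
    ((K : ℝ) * ((Nat.primeCounting ⌊x⌋₊ : ℝ) - 1)) ^ 2 ≤
      (x / 2 + 1 + K) * (K * ((Nat.primeCounting ⌊x⌋₊ : ℝ) - 1) + 2 *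
        ∑ k ∈ Finset.Icc 1 K, ((K : ℝ) - k) * (primePairCount (2 * k) x : ℝ)) := by
  have hx0 : 0 ≤ x := by linarith
  obtain ⟨N, hN⟩ : ∃ N, N = ⌊x⌋₊ := ⟨_, rfl⟩
  rw [← hN]
  have hN2 : 2 ≤ N := hN ▸ Nat.le_floor (by exact_mod_cast hx)
  obtain ⟨A, hA⟩ : ∃ A, A = (Finset.range ((N + 1) / 2)).filter fun m => (2 * m + 1).Prime :=
    ⟨_, rfl⟩
  have hcard : (Nat.primeCounting N : ℝ) - 1 = A.card := by
    rw [primeCounting_eq_card_odd_add_one hN2, ← hA]; push_cast; ring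
  have key := sq_card_le_sum_card_pairs A (M := (N + 1) / 2) K (fun m hm => by
    subst hA; simpa using (Finset.mem_filter.1 hm).1)
  have hpair : ∀ k, (A.filter fun m => m + k ∈ A).card ≤ primePairCount (2 * k) x := by
    intro k
    refine Finset.card_le_card_of_injOn (fun m => 2 * m + 1) ?_ (fun a _ b _ h => by simpa using h)
    intro m hm
    simp only [hA, Finset.coe_filter, Finset.mem_filter, Finset.mem_range, Set.mem_ofPred_eq] at hm
    simp only [← hN, Finset.coe_filter, Finset.mem_Iic, Set.mem_ofPred_eq]
    refine ⟨by omega, hm.1.2, ?_⟩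
    have := hm.2.2
    rwa [show 2 * m + 1 + 2 * k = 2 * (m + k) + 1 by ring]
  have hM : (((N + 1) / 2 : ℕ) : ℝ) ≤ x / 2 + 1 := by
    have h1 : (N : ℝ) ≤ x := hN ▸ Nat.floor_le hx0
    have h2 : ((((N + 1) / 2 : ℕ) : ℝ)) ≤ ((N + 1 : ℕ) : ℝ) / 2 := Nat.cast_div_le
    push_cast at h2
    linarith
  have key' : ((K : ℝ) * A.card) ^ 2 ≤ ((((N + 1) / 2 : ℕ) : ℝ) + K) * (K * A.card +
      2 * ∑ k ∈ Finset.Icc 1 K, ((K - k : ℕ) : ℝ) * ((A.filter fun m => m + k ∈ A).card : ℝ)) := by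
    exact_mod_cast key
  rw [hcard]
  have hsum : ∑ k ∈ Finset.Icc 1 K, ((K - k : ℕ) : ℝ) * ((A.filter fun m => m + k ∈ A).card : ℝ) ≤
      ∑ k ∈ Finset.Icc 1 K, ((K : ℝ) - k) * (primePairCount (2 * k) x : ℝ) := by
    refine Finset.sum_le_sum fun k hk => ?_
    rw [Nat.cast_sub (Finset.mem_Icc.1 hk).2]
    exact mul_le_mul_of_nonneg_left (Nat.cast_le.2 (hpair k))
      (sub_nonneg.2 (Nat.cast_le.2 (Finset.mem_Icc.1 hk).2))
  refine key'.trans (mul_le_mul (by linarith) (by linarith) ?_ (by positivity))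
  exact add_nonneg (by positivity) (mul_nonneg zero_le_two
    (Finset.sum_nonneg fun k _ => by positivity))

/-! ### Fejér kernel -/

/-- The Fejér kernel. -/
noncomputable def fejerKernel (r : ℝ) : ℝ := 2 * (1 - Real.cos r) / r ^ 2

lemma fejerKernel_nonneg (r : ℝ) : 0 ≤ fejerKernel r := by
  have := Real.cos_le_one r
  unfold fejerKernel
  have : 0 ≤ 1 - Real.cos r := by linarith
  positivity

lemma measurable_fejerKernel : Measurable fejerKernel := by
  unfold fejerKernel; fun_prop

lemma fejerKernel_mul_sq_le (r : ℝ) : fejerKernel r * r ^ 2 ≤ 4 := by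
  have := Real.neg_one_le_cos r
  unfold fejerKernel
  rcases eq_or_ne r 0 with rfl | hr
  · simp
  · rw [div_mul_cancel₀ _ (by positivity)]; linarith

lemma fejerKernel_le_one (r : ℝ) : fejerKernel r ≤ 1 := by
  have := Real.one_sub_sq_div_two_le_cos (x := r)
  unfold fejerKernel
  rcases eq_or_ne r 0 with rfl | hr
  · simp
  · rw [div_le_one (by positivity)]; linarith

lemma fejerKernel_le (r : ℝ) : fejerKernel r ≤ 5 * (1 + r ^ 2)⁻¹ := by
  rw [← div_eq_mul_inv, le_div_iff₀ (by positivity)]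
  linarith [fejerKernel_le_one r, fejerKernel_mul_sq_le r]


lemma integrable_fejerKernel : Integrable fejerKernel := by
  refine (integrable_inv_one_add_sq.const_mul 5).mono' measurable_fejerKernel.aestronglyMeasurable
    (ae_of_all _ fun r => ?_)
  rw [Real.norm_of_nonneg (fejerKernel_nonneg r)]
  exact fejerKernel_le r

lemma integral_fejerKernel_pos : 0 < ∫ r, fejerKernel r := by
  rw [integral_pos_iff_support_of_nonneg fejerKernel_nonneg integrable_fejerKernel]
  refine lt_of_lt_of_le ?_ (measure_mono (s := Set.Ioo (0 : ℝ) 1) ?_)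
  · simp
  · intro r hr
    have h1 : Real.cos r < 1 := by
      rw [← Real.cos_zero]
      exact Real.cos_lt_cos_of_nonneg_of_le_pi le_rfl (by linarith [hr.2, Real.pi_gt_three]) hr.1
    have : 0 < fejerKernel r := by
      unfold fejerKernel
      have := hr.1
      have : 0 < 1 - Real.cos r := by linarith
      positivity
    exact this.ne'

/-- The kernel is the Fourier transform of a triangle, folded onto `[0, l]` by evenness. `r = 0` is
excluded because division by zero gives `fejerKernel 0 = 0` instead of 1. -/
lemma intervalIntegral_triangle_mul_cos {l r : ℝ} (hl : 0 < l) (hr : r ≠ 0) :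
    ∫ u in (0 : ℝ)..l, 2 * (1 - u / l) * Real.cos (u * r) = l * fejerKernel (l * r) := by
  have h : ∀ u ∈ Set.uIcc 0 l, HasDerivAt
      (fun u : ℝ => 2 * ((1 - u / l) * (Real.sin (u * r) / r) - Real.cos (u * r) / (l * r ^ 2)))
      (2 * (1 - u / l) * Real.cos (u * r)) u := by
    intro u _
    have h1 : HasDerivAt (fun u : ℝ => u * r) r u := by simpa using (hasDerivAt_id u).mul_const r
    have h2 : HasDerivAt (fun u : ℝ => 1 - u / l) (-(1 / l)) u := by
      simpa using ((hasDerivAt_id u).div_const l).const_sub 1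
    have := (((h2.mul (h1.sin.div_const r)).sub (h1.cos.div_const (l * r ^ 2))).const_mul 2)
    refine this.congr_deriv ?_
    field_simp
    ring
  rw [intervalIntegral.integral_eq_sub_of_hasDerivAt h
    (Continuous.intervalIntegrable (by fun_prop) _ _)]
  unfold fejerKernel
  simp
  field_simp
  ring

lemma integrable_fejerKernel_comp {l : ℝ} (hl : 0 < l) (y : ℝ) :
    Integrable fun t => l * fejerKernel (l * (y - t)) := by
  have := (integrable_fejerKernel.comp_mul_left' hl.ne').const_mul l
  exact this.comp_sub_left y

lemma integral_fejerKernel_comp {l : ℝ} (hl : 0 < l) (y : ℝ) :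
    ∫ t, l * fejerKernel (l * (y - t)) = ∫ r, fejerKernel r := by
  rw [integral_sub_left_eq_self (fun t => l * fejerKernel (l * t)) volume y, integral_const_mul,
    Measure.integral_comp_mul_left fejerKernel l, abs_of_pos (inv_pos.2 hl), smul_eq_mul,
    mul_inv_cancel_left₀ hl.ne']

/-- After `t ↦ y - t` this is the mass of the scaled kernel on `(-∞, y)`, which exhausts the line.
-/
lemma tendsto_setIntegral_fejerKernel {l : ℝ} (hl : 0 < l) :
    Tendsto (fun y => ∫ t in Set.Ioi 0, l * fejerKernel (l * (y - t))) atTop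
      (nhds (∫ r, fejerKernel r)) := by
  have h : ∀ y, ∫ t in Set.Ioi 0, l * fejerKernel (l * (y - t)) =
      ∫ t in Set.Iio y, l * fejerKernel (l * t) := by
    intro y
    rw [← integral_indicator measurableSet_Ioi, ← integral_indicator measurableSet_Iio,
      ← integral_sub_left_eq_self (fun t => (Set.Iio y).indicator _ t) volume y]
    congr 1
    ext t
    simp [Set.indicator]
  simp_rw [h]
  have := (aecover_Iio (μ := volume) (b := fun y : ℝ => y) tendsto_id).integral_tendsto_of_countably_generated
    (by simpa using integrable_fejerKernel_comp hl 0 |>.comp_neg)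
  convert! this using 2
  have := integral_fejerKernel_comp hl 0
  simpa using ((integral_neg_eq_self (fun t => l * fejerKernel (l * t)) volume).symm.trans (by simpa using this)).symm

/-! ### Fejér means and Laplace transforms -/

/-- Fubini for the damped Laplace transform against the triangle function. -/
lemma integral_mul_exp_mul_fejerKernel {b : ℝ → ℝ} (hb : Measurable b) {M : ℝ}
    (hM : ∀ t, |b t| ≤ M) {e : ℝ} (he : 0 < e) {l : ℝ} (hl : 0 < l) (y : ℝ) :
    ∫ t in Set.Ioi 0, b t * Real.exp (-(e * t)) * (l * fejerKernel (l * (y - t))) =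
      ∫ u in (0 : ℝ)..l, 2 * (1 - u / l) *
        (Complex.exp (u * y * Complex.I) *
          ∫ t in Set.Ioi (0 : ℝ), (b t : ℂ) * Complex.exp (-((e + u * Complex.I) * t))).re := by
  have hexp : IntegrableOn (fun t : ℝ => Real.exp (-(e * t))) (Set.Ioi 0) := by
    simpa [neg_mul] using integrableOn_exp_mul_Ioi (neg_lt_zero.2 he) 0
  have hcos : ∀ u : ℝ, (Complex.exp (u * y * Complex.I) *
      ∫ t in Set.Ioi (0 : ℝ), (b t : ℂ) * Complex.exp (-((e + u * Complex.I) * t))).re =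
      ∫ t in Set.Ioi (0 : ℝ), b t * Real.exp (-(e * t)) * Real.cos (u * (y - t)) := by
    intro u
    have hpt : ∀ t : ℝ, Complex.exp (u * y * Complex.I) *
        ((b t : ℂ) * Complex.exp (-((e + u * Complex.I) * t))) =
        ((b t * Real.exp (-(e * t)) : ℝ) : ℂ) * Complex.exp ((u * (y - t) : ℝ) * Complex.I) := by
      intro t
      push_cast
      rw [mul_left_comm, ← Complex.exp_add, mul_assoc (b t : ℂ), ← Complex.exp_add]
      congr 2; ring
    rw [← integral_const_mul]
    simp_rw [hpt]
    have hint : IntegrableOn (fun t : ℝ => ((b t * Real.exp (-(e * t)) : ℝ) : ℂ) *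
        Complex.exp ((u * (y - t) : ℝ) * Complex.I)) (Set.Ioi 0) := by
      refine (hexp.const_mul M).mono' (by fun_prop) (ae_of_all _ fun t => ?_)
      rw [norm_mul, Complex.norm_exp_ofReal_mul_I, mul_one, Complex.norm_real, norm_mul,
        Real.norm_of_nonneg (Real.exp_nonneg _)]
      exact mul_le_mul_of_nonneg_right (hM t) (Real.exp_nonneg _)
    rw [← Complex.reCLM_apply, ← ContinuousLinearMap.integral_comp_comm _ hint]
    refine integral_congr_ae (ae_of_all _ fun t => ?_)
    simp only [Complex.reCLM_apply, Complex.re_ofReal_mul, Complex.exp_ofReal_mul_I_re]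
  simp_rw [hcos, ← integral_const_mul]
  rw [intervalIntegral.integral_of_le hl.le, integral_integral_swap]
  · refine integral_congr_ae ?_
    have hne : ∀ᵐ t : ℝ ∂(volume.restrict (Set.Ioi 0)), t ≠ y :=
      ae_restrict_of_ae (Measure.ae_ne volume y)
    filter_upwards [hne] with t ht
    rw [← intervalIntegral_triangle_mul_cos hl (sub_ne_zero.2 ht.symm),
      ← intervalIntegral.integral_of_le hl.le, ← intervalIntegral.integral_const_mul]
    refine intervalIntegral.integral_congr fun u _ => ?_
    ring
  · have hbound : Integrable (fun p : ℝ × ℝ => (2 * M) * Real.exp (-(e * p.2)))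
        ((volume.restrict (Set.Ioc 0 l)).prod (volume.restrict (Set.Ioi 0))) := by
      have h1 : Integrable (fun _ : ℝ => 2 * M) (volume.restrict (Set.Ioc 0 l)) :=
        integrable_const _
      exact h1.mul_prod hexp
    refine hbound.mono' (Measurable.aestronglyMeasurable (by unfold Function.uncurry; fun_prop)) ?_
    rw [Measure.prod_restrict]
    refine (ae_restrict_iff' (measurableSet_Ioc.prod measurableSet_Ioi)).2 (ae_of_all _ ?_)
    rintro ⟨u, t⟩ ⟨⟨hu0, hul⟩, -⟩
    simp only at hu0 hul
    have hu1 : u / l ≤ 1 := (div_le_one hl).2 hul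
    have hu2 : 0 ≤ u / l := by positivity
    have h1 : ‖2 * (1 - u / l)‖ ≤ 2 := by
      rw [Real.norm_eq_abs, abs_le]; constructor <;> linarith
    have h2 := Real.abs_cos_le_one (u * (y - t))
    have h3 := hM t
    have hM0 : 0 ≤ M := (abs_nonneg _).trans h3
    simp only [Function.uncurry]
    rw [norm_mul, norm_mul (b t * _), norm_mul (b t), Real.norm_of_nonneg (Real.exp_nonneg _)]
    calc ‖2 * (1 - u / l)‖ * (‖b t‖ * Real.exp (-(e * t)) * ‖Real.cos (u * (y - t))‖)
        ≤ 2 * (M * Real.exp (-(e * t)) * 1) := by gcongr <;> assumption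
      _ = _ := by ring

/-- Let the damping `e` tend to `0+`. The left side is dominated by a multiple of the kernel, the
right by the bound of `G` on the compact rectangle `[0, 1] × [0, l]`. -/
lemma setIntegral_mul_fejerKernel_eq {b : ℝ → ℝ} (hb : Measurable b) {M : ℝ}
    (hM : ∀ t, |b t| ≤ M) {G : ℂ → ℂ} (hG : ContinuousOn G {s | 0 ≤ s.re})
    (hbG : ∀ s : ℂ, 0 < s.re →
      ∫ t in Set.Ioi (0 : ℝ), (b t : ℂ) * Complex.exp (-(s * t)) = G s)
    {l : ℝ} (hl : 0 < l) (y : ℝ) :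
    ∫ t in Set.Ioi 0, b t * (l * fejerKernel (l * (y - t))) =
      ∫ u in (0 : ℝ)..l, 2 * (1 - u / l) *
        (Complex.exp (u * y * Complex.I) * G (u * Complex.I)).re := by
  have hM0 : 0 ≤ M := (abs_nonneg _).trans (hM 0)
  have hL : Tendsto (fun e : ℝ => ∫ t in Set.Ioi 0, b t * Real.exp (-(e * t)) *
      (l * fejerKernel (l * (y - t)))) (𝓝[>] 0)
      (𝓝 (∫ t in Set.Ioi 0, b t * (l * fejerKernel (l * (y - t))))) := by
    refine tendsto_integral_filter_of_dominated_convergence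
      (fun t => M * (l * fejerKernel (l * (y - t)))) ?_ ?_
      ((integrable_fejerKernel_comp hl y).const_mul M).integrableOn ?_
    · refine Eventually.of_forall fun e => ?_
      have := measurable_fejerKernel
      fun_prop
    · filter_upwards [self_mem_nhdsWithin] with e he
      refine (ae_restrict_iff' measurableSet_Ioi).2 (ae_of_all _ fun t ht => ?_)
      have h1 : Real.exp (-(e * t)) ≤ 1 := by
        rw [Real.exp_le_one_iff]
        have : 0 ≤ e * t := mul_nonneg (le_of_lt he) (le_of_lt ht)
        linarith
      have h2 : 0 ≤ l * fejerKernel (l * (y - t)) := mul_nonneg hl.le (fejerKernel_nonneg _)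
      rw [norm_mul, norm_mul, Real.norm_of_nonneg h2, Real.norm_of_nonneg (Real.exp_nonneg _)]
      refine mul_le_mul_of_nonneg_right ?_ h2
      calc ‖b t‖ * Real.exp (-(e * t)) ≤ M * 1 :=
            mul_le_mul (hM t) h1 (Real.exp_nonneg _) hM0
        _ = M := mul_one M
    · refine ae_of_all _ fun t => ?_
      have : Continuous fun e : ℝ => b t * Real.exp (-(e * t)) * (l * fejerKernel (l * (y - t))) := by
        fun_prop
      have h := (this.tendsto 0).mono_left (nhdsWithin_le_nhds (s := Set.Ioi 0))
      simpa using h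
  have hmaps : ∀ p ∈ Set.Icc (0 : ℝ) 1 ×ˢ Set.Icc (0 : ℝ) l,
      (p.1 + p.2 * Complex.I : ℂ) ∈ {s : ℂ | 0 ≤ s.re} := by
    rintro ⟨e, u⟩ ⟨⟨h, -⟩, -⟩
    simpa using h
  have hcont : ContinuousOn (fun p : ℝ × ℝ => G (p.1 + p.2 * Complex.I))
      (Set.Icc (0 : ℝ) 1 ×ˢ Set.Icc (0 : ℝ) l) :=
    hG.comp (Continuous.continuousOn (by fun_prop)) hmaps
  obtain ⟨B, hB⟩ := (isCompact_Icc.prod isCompact_Icc).exists_bound_of_continuousOn hcont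
  have hR : Tendsto (fun e : ℝ => ∫ u in (0 : ℝ)..l, 2 * (1 - u / l) *
        (Complex.exp (u * y * Complex.I) * G (e + u * Complex.I)).re) (𝓝[>] 0)
      (𝓝 (∫ u in (0 : ℝ)..l, 2 * (1 - u / l) *
        (Complex.exp (u * y * Complex.I) * G (u * Complex.I)).re)) := by
    have hev : ∀ᶠ e : ℝ in 𝓝[>] 0, e ∈ Set.Ioc (0 : ℝ) 1 := Ioc_mem_nhdsGT one_pos
    refine intervalIntegral.tendsto_integral_filter_of_dominated_convergence (fun _ => 2 * B)
      ?_ ?_ intervalIntegrable_const ?_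
    · filter_upwards [hev] with e he
      rw [Set.uIoc_of_le hl.le]
      refine ContinuousOn.aestronglyMeasurable ?_ measurableSet_Ioc
      have : ContinuousOn (fun u : ℝ => G (e + u * Complex.I)) (Set.Ioc 0 l) :=
        hcont.comp (f := fun u => (e, u)) (by fun_prop)
          (fun u hu => ⟨⟨he.1.le, he.2⟩, ⟨hu.1.le, hu.2⟩⟩)
      refine ContinuousOn.mul (by fun_prop) (Complex.continuous_re.comp_continuousOn
        (ContinuousOn.mul (by fun_prop) this))
    · filter_upwards [hev] with e he
      refine ae_of_all _ fun u hu => ?_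
      rw [Set.uIoc_of_le hl.le] at hu
      have hu1 : u / l ≤ 1 := (div_le_one hl).2 hu.2
      have hu2 : 0 ≤ u / l := div_nonneg hu.1.le hl.le
      have h1 : ‖2 * (1 - u / l)‖ ≤ 2 := by
        rw [Real.norm_eq_abs, abs_le]; constructor <;> linarith
      have h2 : ‖(Complex.exp (u * y * Complex.I) * G (e + u * Complex.I)).re‖ ≤ B := by
        refine (Complex.abs_re_le_norm _).trans ?_
        rw [norm_mul, ← Complex.ofReal_mul, Complex.norm_exp_ofReal_mul_I, one_mul]
        exact hB (e, u) ⟨⟨he.1.le, he.2⟩, ⟨hu.1.le, hu.2⟩⟩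
      rw [norm_mul]
      exact mul_le_mul h1 h2 (norm_nonneg _) zero_le_two
    · refine ae_of_all _ fun u hu => ?_
      rw [Set.uIoc_of_le hl.le] at hu
      have h1 : Tendsto (fun e : ℝ => ((e : ℂ) + u * Complex.I)) (𝓝[>] 0)
          (𝓝[{s : ℂ | 0 ≤ s.re}] (u * Complex.I)) := by
        refine tendsto_nhdsWithin_iff.2 ⟨?_, ?_⟩
        · have : Continuous fun e : ℝ => ((e : ℂ) + u * Complex.I) := by fun_prop
          simpa using (this.tendsto 0).mono_left (nhdsWithin_le_nhds (s := Set.Ioi 0))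
        · filter_upwards [hev] with e he
          simpa using he.1.le
      have h2 : Tendsto (fun e : ℝ => G (e + u * Complex.I)) (𝓝[>] 0) (𝓝 (G (u * Complex.I))) :=
        (hG (u * Complex.I) (by simp)).tendsto.comp h1
      exact (((Complex.continuous_re.tendsto _).comp (h2.const_mul _)).const_mul _)
  refine tendsto_nhds_unique hL (hR.congr' ?_)
  filter_upwards [self_mem_nhdsWithin] with e he
  rw [integral_mul_exp_mul_fejerKernel hb hM he hl y]
  refine intervalIntegral.integral_congr fun u _ => ?_
  rw [hbG _ (by simpa using he)]

/-- A bounded function whose Laplace transform extends continuously to `0 ≤ re s` has vanishing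
Fejér means at infinity. -/
lemma tendsto_setIntegral_mul_fejerKernel {b : ℝ → ℝ} (hb : Measurable b) {M : ℝ}
    (hM : ∀ t, |b t| ≤ M) {G : ℂ → ℂ} (hG : ContinuousOn G {s | 0 ≤ s.re})
    (hbG : ∀ s : ℂ, 0 < s.re →
      ∫ t in Set.Ioi (0 : ℝ), (b t : ℂ) * Complex.exp (-(s * t)) = G s)
    {l : ℝ} (hl : 0 < l) :
    Tendsto (fun y => ∫ t in Set.Ioi 0, b t * (l * fejerKernel (l * (y - t)))) atTop (𝓝 0) := by
  simp_rw [setIntegral_mul_fejerKernel_eq hb hM hG hbG hl]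
  set f : ℝ → ℂ := (Set.Ioc 0 l).indicator fun u => 2 * (1 - u / l) * G (u * Complex.I) with hf
  have hGc : ContinuousOn (fun u : ℝ => G (u * Complex.I)) (Set.Icc 0 l) :=
    hG.comp (Continuous.continuousOn (by fun_prop)) fun u _ => by simp
  -- Riemann–Lebesgue; the frequency `-(y / (2π))` turns the character into `exp (i u y)`.
  have hRL := (Real.tendsto_integral_exp_smul_cocompact f).comp
    (show Tendsto (fun y : ℝ => -(y / (2 * Real.pi))) atTop (cocompact ℝ) from
      (tendsto_neg_atTop_atBot.comp (tendsto_id.atTop_div_const (by positivity))).mono_right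
        atBot_le_cocompact)
  have hre := (Complex.continuous_re.tendsto _).comp hRL
  rw [Complex.zero_re] at hre
  refine hre.congr fun y => ?_
  simp only [Function.comp]
  have h1 : ∀ u : ℝ, Real.fourierChar (-(u * -(y / (2 * Real.pi)))) • f u =
      (Set.Ioc 0 l).indicator (fun u : ℝ => ((2 * (1 - u / l) : ℝ) : ℂ) *
        (Complex.exp (u * y * Complex.I) * G (u * Complex.I))) u := by
    intro u
    by_cases hu : u ∈ Set.Ioc 0 l
    · rw [hf, Set.indicator_of_mem hu, Set.indicator_of_mem hu, Circle.smul_def,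
        Real.fourierChar_apply, smul_eq_mul]
      have : ((2 * Real.pi * -(u * -(y / (2 * Real.pi))) : ℝ) : ℂ) * Complex.I =
          u * y * Complex.I := by
        have : 2 * Real.pi * -(u * -(y / (2 * Real.pi))) = u * y := by field_simp
        rw [this]; push_cast; ring
      rw [this]; push_cast; ring
    · rw [hf, Set.indicator_of_notMem hu, Set.indicator_of_notMem hu, smul_zero]
  simp_rw [h1]
  rw [integral_indicator measurableSet_Ioc, intervalIntegral.integral_of_le hl.le]
  have hint : IntegrableOn (fun u : ℝ => ((2 * (1 - u / l) : ℝ) : ℂ) *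
        (Complex.exp (u * y * Complex.I) * G (u * Complex.I))) (Set.Ioc 0 l) := by
    refine (ContinuousOn.integrableOn_Icc ?_).mono_set Set.Ioc_subset_Icc_self
    exact ContinuousOn.mul (by fun_prop) (ContinuousOn.mul (by fun_prop) hGc)
  rw [← Complex.reCLM_apply, ← ContinuousLinearMap.integral_comp_comm _ hint]
  simp only [Complex.reCLM_apply, Complex.re_ofReal_mul]

/-! ### Tauberian argument -/

/-- Lower half of the Wiener--Ikehara theorem for bounded functions. -/
theorem eventually_ge_of_laplace_continuousOn {a : ℝ → ℝ} (ha : Measurable a) {M : ℝ}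
    (h0 : ∀ t, 0 ≤ a t) (hM : ∀ t, a t ≤ M)
    (hmono : Monotone fun t => a t * Real.exp t)
    {G : ℂ → ℂ} (hG : ContinuousOn G {s | 0 ≤ s.re})
    (haG : ∀ s : ℂ, 0 < s.re →
      ∫ t in Set.Ioi (0 : ℝ), ((a t - 1 : ℝ) : ℂ) * Complex.exp (-(s * t)) = G s)
    {η : ℝ} (hη : 0 < η) : ∀ᶠ y in atTop, 1 - η ≤ a y := by
  set c := ∫ r, fejerKernel r with hc
  have hcpos : 0 < c := integral_fejerKernel_pos
  have hM0 : 0 ≤ M := (h0 0).trans (hM 0)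
  obtain ⟨δ, hδ, hδη⟩ : ∃ δ : ℝ, 0 < δ ∧ Real.exp (2 * δ) * (1 - η) < 1 := by
    have : Tendsto (fun δ : ℝ => Real.exp (2 * δ) * (1 - η)) (𝓝[>] 0) (𝓝 (1 - η)) := by
      have h : Continuous fun δ : ℝ => Real.exp (2 * δ) * (1 - η) := by fun_prop
      simpa using (h.tendsto 0).mono_left (nhdsWithin_le_nhds (s := Set.Ioi 0))
    obtain ⟨δ, h1, h2⟩ := ((this.eventually_lt_const (show 1 - η < 1 by linarith)).and
      self_mem_nhdsWithin).exists
    exact ⟨δ, h2, h1⟩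
  set γ := 1 - Real.exp (2 * δ) * (1 - η) with hγ
  have hγpos : 0 < γ := by linarith
  set D := M * (4 * (1 + 1 / δ ^ 2)) * Real.pi with hD
  have hD0 : 0 ≤ D := by positivity
  -- The tail of the mean is at most `D / l`, a third of the deficit `γ * c`; `D + 1` keeps `l`
  -- positive when `D = 0`.
  set l := 3 * (D + 1) / (γ * c) with hl_def
  have hl : 0 < l := by positivity
  have hDl : D / l ≤ γ * c / 3 := by
    rw [hl_def, div_div_eq_mul_div, div_le_div_iff₀ (by positivity) (by positivity)]
    have : 0 < γ * c := by positivity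
    nlinarith
  have hA : Tendsto (fun y => ∫ t in Set.Ioi 0, a t * (l * fejerKernel (l * (y - t)))) atTop
      (𝓝 c) := by
    have h1 := tendsto_setIntegral_mul_fejerKernel (b := fun t => a t - 1) (M := M + 1)
      (by fun_prop) (fun t => by rw [abs_le]; constructor <;> linarith [h0 t, hM t]) hG haG hl
    have h2 := h1.add (tendsto_setIntegral_fejerKernel hl)
    rw [zero_add] at h2
    refine h2.congr fun y => ?_
    have hk := (integrable_fejerKernel_comp hl y).integrableOn (s := Set.Ioi 0)
    have hbk : IntegrableOn (fun t => (a t - 1) * (l * fejerKernel (l * (y - t)))) (Set.Ioi 0) := by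
      refine hk.bdd_mul (c := M + 1) (by fun_prop) (ae_of_all _ fun t => ?_)
      rw [Real.norm_eq_abs, abs_le]; constructor <;> linarith [h0 t, hM t]
    rw [← integral_add hbk hk]
    refine integral_congr_ae (ae_of_all _ fun t => ?_)
    simp only
    ring
  -- Centring at `y - δ` puts the core of the kernel on `[y - 2δ, y]`, where monotonicity bounds `a
  -- t` by `exp (2δ) * a y`.
  have hA' := hA.comp (tendsto_atTop_add_const_right atTop (-δ) tendsto_id)
  filter_upwards [hA'.eventually_const_lt (show c - γ * c / 3 < c by
    have : 0 < γ * c := by positivity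
    linarith)] with y hy
  simp only [Function.comp, id] at hy
  by_contra! hlt
  have hup : ∫ t in Set.Ioi 0, a t * (l * fejerKernel (l * (y + -δ - t))) ≤
      Real.exp (2 * δ) * (1 - η) * c + D / l := by
    have hk := integrable_fejerKernel_comp hl (y + -δ)
    have hq : Integrable fun t => (1 + (y + -δ - t) ^ 2)⁻¹ :=
      integrable_inv_one_add_sq.comp_sub_left (y + -δ)
    have hpos : ∀ t, 0 ≤ l * fejerKernel (l * (y + -δ - t)) :=
      fun t => mul_nonneg hl.le (fejerKernel_nonneg _)
    have hη1 : 0 ≤ 1 - η := (h0 y).trans hlt.le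
    have hpt : ∀ t, a t * (l * fejerKernel (l * (y + -δ - t))) ≤
        Real.exp (2 * δ) * (1 - η) * (l * fejerKernel (l * (y + -δ - t))) +
        M * (4 * (1 + 1 / δ ^ 2)) / l * (1 + (y + -δ - t) ^ 2)⁻¹ := by
      intro t
      rcases le_or_gt |y + -δ - t| δ with h | h
      · rw [abs_le] at h
        have h1 := hmono (show t ≤ y by linarith)
        have h2 : a t ≤ Real.exp (2 * δ) * (1 - η) := by
          calc a t = a t * Real.exp t * Real.exp (-t) := by
                rw [mul_assoc, ← Real.exp_add]; simp
            _ ≤ a y * Real.exp y * Real.exp (-t) :=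
                mul_le_mul_of_nonneg_right h1 (Real.exp_nonneg _)
            _ = Real.exp (y - t) * a y := by
                rw [mul_assoc, ← Real.exp_add, ← sub_eq_add_neg, mul_comm]
            _ ≤ Real.exp (2 * δ) * (1 - η) :=
                mul_le_mul (Real.exp_le_exp.2 (by linarith)) hlt.le (h0 y) (Real.exp_nonneg _)
        have h3 := mul_le_mul_of_nonneg_right h2 (hpos t)
        have h4 : 0 ≤ M * (4 * (1 + 1 / δ ^ 2)) / l * (1 + (y + -δ - t) ^ 2)⁻¹ := by positivity
        linarith
      · set r := y + -δ - t with hr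
        have hr2 : δ ^ 2 < r ^ 2 := by
          rw [← sq_abs r]; exact pow_lt_pow_left₀ h hδ.le two_ne_zero
        have hr0 : 0 < r ^ 2 := lt_trans (by positivity) hr2
        have h1 : l * fejerKernel (l * r) ≤ 4 * (1 + 1 / δ ^ 2) / l * (1 + r ^ 2)⁻¹ := by
          have h2 := fejerKernel_mul_sq_le (l * r)
          have h3 : l * fejerKernel (l * r) ≤ 4 / (l * r ^ 2) := by
            rw [le_div_iff₀ (by positivity)]
            linarith
          have h4 : 1 / r ^ 2 ≤ (1 + 1 / δ ^ 2) * (1 + r ^ 2)⁻¹ := by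
            rw [← div_eq_mul_inv, div_le_div_iff₀ hr0 (by positivity), one_mul, add_mul, one_mul]
            have : 1 ≤ 1 / δ ^ 2 * r ^ 2 := by
              rw [one_div_mul_eq_div, one_le_div (by positivity)]; exact hr2.le
            linarith
          calc _ ≤ 4 / (l * r ^ 2) := h3
            _ = 4 / l * (1 / r ^ 2) := by field_simp
            _ ≤ 4 / l * ((1 + 1 / δ ^ 2) * (1 + r ^ 2)⁻¹) := by gcongr
            _ = _ := by ring
        have h5 : a t * (l * fejerKernel (l * r)) ≤
            M * (4 * (1 + 1 / δ ^ 2) / l * (1 + r ^ 2)⁻¹) :=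
          mul_le_mul (hM t) h1 (hpos t) hM0
        have h6 := mul_nonneg (mul_nonneg (Real.exp_nonneg (2 * δ)) hη1) (hpos t)
        have h7 : M * (4 * (1 + 1 / δ ^ 2) / l * (1 + r ^ 2)⁻¹) =
          M * (4 * (1 + 1 / δ ^ 2)) / l * (1 + r ^ 2)⁻¹ := by ring
        linarith
    have hak : Integrable (fun t => a t * (l * fejerKernel (l * (y + -δ - t)))) := by
      refine hk.bdd_mul (c := M) (by fun_prop) (ae_of_all _ fun t => ?_)
      rw [Real.norm_of_nonneg (h0 t)]; exact hM t
    calc _ ≤ ∫ t, a t * (l * fejerKernel (l * (y + -δ - t))) :=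
          setIntegral_le_integral hak (ae_of_all _ fun t => mul_nonneg (h0 t) (hpos t))
      _ ≤ ∫ t, (Real.exp (2 * δ) * (1 - η) * (l * fejerKernel (l * (y + -δ - t))) +
            M * (4 * (1 + 1 / δ ^ 2)) / l * (1 + (y + -δ - t) ^ 2)⁻¹) :=
          integral_mono hak ((hk.const_mul _).add (hq.const_mul _)) hpt
      _ = _ := by
          rw [integral_add (hk.const_mul _) (hq.const_mul _),
            integral_const_mul (Real.exp (2 * δ) * (1 - η)), integral_fejerKernel_comp hl,
            integral_const_mul,
            integral_sub_left_eq_self (fun t => (1 + t ^ 2)⁻¹) volume (y + -δ),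
            integral_univ_inv_one_add_sq]
          ring
  have : Real.exp (2 * δ) * (1 - η) * c = c - γ * c := by rw [hγ]; ring
  have : 0 < γ * c := by positivity
  linarith

/-! ### Lower bound in the prime number theorem -/

open ArithmeticFunction in
/-- `L(Λ, s) - 1 / (s - 1)` extends continuously to `1 ≤ re s`. -/
lemma exists_continuousOn_LSeries_vonMangoldt_sub :
    ∃ H : ℂ → ℂ, ContinuousOn H {s | 1 ≤ s.re} ∧ ∀ s : ℂ, 1 < s.re →
      LSeries (fun n => (vonMangoldt n : ℂ)) s = H s + 1 / (s - 1) := by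
  refine ⟨vonMangoldt.LFunctionResidueClassAux (1 : ZMod 1),
    vonMangoldt.continuousOn_LFunctionResidueClassAux _, fun s hs => ?_⟩
  rw [vonMangoldt.eqOn_LFunctionResidueClassAux isUnit_one hs]
  have : vonMangoldt.residueClass (1 : ZMod 1) = fun n => vonMangoldt n := by
    ext n
    have hn : n ∈ {n : ℕ | (n : ZMod 1) = 1} := Subsingleton.elim _ _
    exact Set.indicator_of_mem hn (fun n => vonMangoldt n)
  simp [this]

/-- Abel summation followed by the substitution `x = exp t`; convergence rests on Chebyshev's `ψ(n)
= O(n)`. -/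
lemma LSeries_vonMangoldt_eq_integral_exp {s : ℂ} (hs : 0 < s.re) :
    LSeries (fun n => (ArithmeticFunction.vonMangoldt n : ℂ)) (1 + s) =
      (1 + s) * ∫ t in Set.Ioi (0 : ℝ),
        ((Chebyshev.psi (Real.exp t) * Real.exp (-t) : ℝ) : ℂ) * Complex.exp (-(s * t)) := by
  have hO : (fun n : ℕ => ∑ k ∈ Finset.Icc 1 n, ArithmeticFunction.vonMangoldt k) =O[atTop]
      fun n : ℕ => (n : ℝ) ^ (1 : ℝ) := by
    refine IsBigO.of_bound (Real.log 4 + 4) (Eventually.of_forall fun n => ?_)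
    have h := Chebyshev.psi_le_const_mul_self (x := n) (Nat.cast_nonneg n)
    have h' := Chebyshev.psi_nonneg n
    rw [Chebyshev.psi, Nat.floor_natCast] at h h'
    change ‖∑ k ∈ Finset.Ioc 0 n, ArithmeticFunction.vonMangoldt k‖ ≤ _
    rw [Real.norm_of_nonneg h', Real.rpow_one, Real.norm_of_nonneg (Nat.cast_nonneg n)]
    exact h
  rw [LSeries_eq_mul_integral_of_nonneg _ zero_le_one (by simpa using hs) hO
    (fun n => ArithmeticFunction.vonMangoldt_nonneg)]
  congr 1
  rw [← Real.exp_zero, ← integral_comp_exp_Ioi]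
  refine setIntegral_congr_fun measurableSet_Ioi fun t _ => ?_
  have h1 : (∑ k ∈ Finset.Icc 1 ⌊Real.exp t⌋₊, (ArithmeticFunction.vonMangoldt k : ℂ)) =
      (Chebyshev.psi (Real.exp t) : ℝ) := by
    rw [Chebyshev.psi]; push_cast; rfl
  have h2 : ((Real.exp t : ℝ) : ℂ) ^ (-(1 + s + 1)) = Complex.exp (t * (-(1 + s + 1))) := by
    rw [Complex.cpow_def_of_ne_zero (by exact_mod_cast (Real.exp_pos t).ne'),
      ← Complex.ofReal_log (Real.exp_pos t).le, Real.log_exp]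
  simp only [h1, h2, Complex.real_smul]
  push_cast
  rw [mul_left_comm, ← Complex.exp_add, mul_assoc, ← Complex.exp_add]
  congr 2
  ring

/-- The lower bound in the prime number theorem. -/
theorem eventually_mul_le_psi {η : ℝ} (hη : 0 < η) :
    ∀ᶠ x : ℝ in atTop, (1 - η) * x ≤ Chebyshev.psi x := by
  obtain ⟨H, hH, hL⟩ := exists_continuousOn_LSeries_vonMangoldt_sub
  have hmeas : Measurable fun t => Chebyshev.psi (Real.exp t) * Real.exp (-t) :=
    (Chebyshev.psi_mono.measurable.comp Real.measurable_exp).mul (by fun_prop)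
  have h0 : ∀ t, 0 ≤ Chebyshev.psi (Real.exp t) * Real.exp (-t) := fun t =>
    mul_nonneg (Chebyshev.psi_nonneg _) (Real.exp_nonneg _)
  have hM : ∀ t, Chebyshev.psi (Real.exp t) * Real.exp (-t) ≤ Real.log 4 + 4 := by
    intro t
    have := Chebyshev.psi_le_const_mul_self (Real.exp_pos t).le
    rwa [Real.exp_neg, ← div_eq_mul_inv, div_le_iff₀ (Real.exp_pos t)]
  have hmono : Monotone fun t => Chebyshev.psi (Real.exp t) * Real.exp (-t) * Real.exp t := by
    have : (fun t => Chebyshev.psi (Real.exp t) * Real.exp (-t) * Real.exp t) =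
        fun t => Chebyshev.psi (Real.exp t) := by
      ext t; rw [mul_assoc, ← Real.exp_add]; simp
    rw [this]
    exact Chebyshev.psi_mono.comp Real.exp_monotone
  -- With `L(Λ, 1 + s) = H (1 + s) + 1 / s`, the poles cancel in `(H (1 + s) + 1 / s) / (1 + s) - 1
  -- / s`, leaving this `G`.
  have key := eventually_ge_of_laplace_continuousOn (a := fun t =>
    Chebyshev.psi (Real.exp t) * Real.exp (-t)) (G := fun s => (H (1 + s) - 1) / (1 + s))
    hmeas h0 hM hmono ?_ ?_ hη
  · filter_upwards [Real.tendsto_log_atTop.eventually key, eventually_gt_atTop 0] with x hx hx0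
    rwa [Real.exp_neg, Real.exp_log hx0, ← div_eq_mul_inv, le_div_iff₀ hx0] at hx
  · refine ContinuousOn.div ((hH.comp (by fun_prop) ?_).sub continuousOn_const) (by fun_prop) ?_
    · intro s hs
      simpa using hs
    · intro s hs h
      have hs' : 0 ≤ s.re := hs
      have : (1 + s).re = 0 := by rw [h]; rfl
      simp at this
      linarith
  · intro s hs
    have hs0 : s ≠ 0 := by rintro rfl; simp at hs
    have hs1 : 1 + s ≠ 0 := by
      intro h
      have : (1 + s).re = 0 := by rw [h]; rfl
      simp at this
      linarith
    have hns : (-s).re < 0 := by simpa using hs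
    have hexp : IntegrableOn (fun t : ℝ => Complex.exp (-(s * t))) (Set.Ioi 0) := by
      simpa [neg_mul] using integrableOn_exp_mul_complex_Ioi hns 0
    have hexpint : ∫ t in Set.Ioi (0 : ℝ), Complex.exp (-(s * t)) = 1 / s := by
      have := integral_exp_mul_complex_Ioi hns 0
      simpa [neg_mul] using this
    have hint : IntegrableOn (fun t : ℝ =>
        ((Chebyshev.psi (Real.exp t) * Real.exp (-t) : ℝ) : ℂ) * Complex.exp (-(s * t)))
        (Set.Ioi 0) := by
      refine hexp.bdd_mul (c := Real.log 4 + 4)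
        (Complex.measurable_ofReal.comp hmeas).aestronglyMeasurable (ae_of_all _ fun t => ?_)
      rw [Complex.norm_real, Real.norm_of_nonneg (h0 t)]
      exact hM t
    have h1 := LSeries_vonMangoldt_eq_integral_exp hs
    rw [hL _ (by simpa using hs), add_sub_cancel_left] at h1
    have h2 : ∀ t : ℝ, ((Chebyshev.psi (Real.exp t) * Real.exp (-t) - 1 : ℝ) : ℂ) *
        Complex.exp (-(s * t)) =
        ((Chebyshev.psi (Real.exp t) * Real.exp (-t) : ℝ) : ℂ) * Complex.exp (-(s * t)) -
          Complex.exp (-(s * t)) := by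
      intro t; push_cast; ring
    simp_rw [h2]
    rw [integral_sub hint hexp, hexpint, eq_div_iff hs1, sub_mul, mul_comm _ (1 + s), ← h1]
    field_simp
    ring

theorem eventually_mul_div_log_le_primeCounting {η : ℝ} (hη : 0 < η) :
    ∀ᶠ x : ℝ in atTop, (1 - η) * (x / Real.log x) ≤ Nat.primeCounting ⌊x⌋₊ := by
  filter_upwards [eventually_mul_le_psi hη, eventually_gt_atTop 1] with x hx h1
  rw [← mul_div_assoc, div_le_iff₀ (Real.log_pos h1)]
  exact hx.trans (Chebyshev.psi_le_primeCounting_mul_log' x)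

/-! ### Asymptotics of the weighted sum -/

/-- The window bound, solved for the weighted sum of the pair counts. -/
lemma le_sum_primePairCount {x : ℝ} (hx : 2 ≤ x) {K : ℕ} (hK : 0 < K) {n : ℝ}
    (hn : n ≤ (Nat.primeCounting ⌊x⌋₊ : ℝ) - 1) (hn0 : 0 ≤ n)
    (hnK : 1 / (2 * K) ≤ n / (x + 2 + 2 * K)) :
    n * (n / (x + 2 + 2 * K) - 1 / (2 * K)) ≤ 1 / (K : ℝ) ^ 2 *
      ∑ k ∈ Finset.Icc 1 K, ((K : ℝ) - k) * (primePairCount (2 * k) x : ℝ) := by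
  have key := sq_primeCounting_le_sum_primePairCount hx K
  set S := ∑ k ∈ Finset.Icc 1 K, ((K : ℝ) - k) * (primePairCount (2 * k) x : ℝ)
  set N := (Nat.primeCounting ⌊x⌋₊ : ℝ) - 1
  have hK0 : (0 : ℝ) < K := Nat.cast_pos.2 hK
  have hY : 0 < x + 2 + 2 * K := by positivity
  have h1 : N * (N / (x + 2 + 2 * K) - 1 / (2 * K)) ≤ 1 / (K : ℝ) ^ 2 * S := by
    have : N * (N / (x + 2 + 2 * K) - 1 / (2 * K)) =
        1 / (K : ℝ) ^ 2 * (((K * N) ^ 2 / (x / 2 + 1 + K) - K * N) / 2) := by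
      have : x / 2 + 1 + K ≠ 0 := by positivity
      field_simp
    rw [this]
    refine mul_le_mul_of_nonneg_left ?_ (by positivity)
    have h2 : (K * N) ^ 2 / (x / 2 + 1 + K) ≤ K * N + 2 * S := by
      rw [div_le_iff₀ (by positivity), mul_comm _ (x / 2 + 1 + K)]
      exact key
    linarith
  -- `hnK` makes the bracket nonnegative, so both factors only grow from `n` to `N`.
  refine le_trans ?_ h1
  have h3 : n / (x + 2 + 2 * K) ≤ N / (x + 2 + 2 * K) := by gcongr
  exact mul_le_mul hn (by linarith) (by linarith) (hn0.trans hn)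

theorem theorem2 (C : ℝ) (hC : 1 / 2 < C) (E : ℝ → ℝ)
    (hlow : ∀ᶠ x : ℝ in atTop, C * Real.log x ≤ E x)
    (hup : E =o[atTop] fun x : ℝ => x / Real.log x ^ 2) :
    AsympGE
      (fun x : ℝ => 1 / (⌊E x⌋₊ : ℝ) ^ 2 *
        ∑ k ∈ Finset.Icc 1 ⌊E x⌋₊, ((⌊E x⌋₊ : ℝ) - (k : ℝ)) * (primePairCount (2 * k) x : ℝ))
      (fun x : ℝ => (1 - 1 / (2 * C)) * (x / Real.log x ^ 2)) := by
  intro ε hε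
  have hC0 : 0 < C := by linarith
  have hL : 0 < 1 - 1 / (2 * C) := by
    rw [sub_pos, div_lt_one (by positivity)]; linarith
  -- One `η` pays for the floor in `K`, for `x + 2 + 2 * K` against `x`, and for `π(x) - 1` against
  -- `x / log x`; the last splits into two halves `η / 2`.
  obtain ⟨η, hη, hη1, hbr, hmain⟩ : ∃ η : ℝ, 0 < η ∧ η < 1 ∧
      0 < (1 - η) / (1 + 3 * η) - 1 / (2 * (C * (1 - η))) ∧
      (1 - ε) * (1 - 1 / (2 * C)) <
        (1 - η) * ((1 - η) / (1 + 3 * η) - 1 / (2 * (C * (1 - η)))) := by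
    have hc : ContinuousAt (fun η : ℝ => (1 - η) / (1 + 3 * η) - 1 / (2 * (C * (1 - η)))) 0 := by
      have h1 : (1 + 3 * (0 : ℝ)) ≠ 0 := by norm_num
      have h2 : 2 * (C * (1 - (0 : ℝ))) ≠ 0 := by simpa using hC0.ne'
      fun_prop (disch := assumption)
    have ht1 : Tendsto (fun η : ℝ => (1 - η) / (1 + 3 * η) - 1 / (2 * (C * (1 - η)))) (𝓝[>] 0)
        (𝓝 (1 - 1 / (2 * C))) := by
      simpa using hc.tendsto.mono_left (nhdsWithin_le_nhds (s := Set.Ioi 0))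
    have ht2 : Tendsto (fun η : ℝ => (1 - η) *
        ((1 - η) / (1 + 3 * η) - 1 / (2 * (C * (1 - η))))) (𝓝[>] 0)
        (𝓝 (1 - 1 / (2 * C))) := by
      have hc2 : ContinuousAt (fun η : ℝ => 1 - η) 0 := by fun_prop
      simpa [Pi.mul_def] using (hc2.mul hc).tendsto.mono_left (nhdsWithin_le_nhds (s := Set.Ioi 0))
    obtain ⟨η, h1, h2, h3⟩ := ((ht1.eventually_const_lt hL).and
      ((ht2.eventually_const_lt (show (1 - ε) * (1 - 1 / (2 * C)) < 1 - 1 / (2 * C) by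
        nlinarith)).and (Ioo_mem_nhdsGT (zero_lt_one (α := ℝ))))).exists
    exact ⟨η, h3.1, h3.2, h1, h2⟩
  have hlog := Real.tendsto_log_atTop
  have hxlog : ∀ᶠ x : ℝ in atTop, 1 ≤ η / 2 * (x / Real.log x) := by
    have h := (Real.isLittleO_log_id_atTop.bound (show 0 < η / 2 by positivity))
    filter_upwards [h, eventually_gt_atTop 1] with x hx hx1
    have hlx := Real.log_pos hx1
    rw [Real.norm_of_nonneg hlx.le, id, Real.norm_of_nonneg (by linarith)] at hx
    rw [← mul_div_assoc, le_div_iff₀ hlx]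
    linarith
  have hClog : ∀ᶠ x : ℝ in atTop, 1 ≤ η * (C * Real.log x) :=
    ((hlog.const_mul_atTop hC0).const_mul_atTop hη).eventually_ge_atTop 1
  have hEx := hup.bound hη
  filter_upwards [hlow, hEx, hxlog, hClog, hlog.eventually_ge_atTop 1, eventually_ge_atTop 2,
    eventually_ge_atTop (2 / η),
    eventually_mul_div_log_le_primeCounting (show 0 < η / 2 by positivity)]
    with x hE1 hE2 h1 h2 h3 h4 h5 h6
  have hl0 : 0 < Real.log x := by linarith
  have hx0 : 0 < x := by linarith
  have hE0 : 0 ≤ E x := le_trans (by positivity) hE1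
  set K := ⌊E x⌋₊ with hK
  have hKle : (K : ℝ) ≤ E x := Nat.floor_le hE0
  have hKge : C * (1 - η) * Real.log x ≤ K := by
    have := Nat.lt_floor_add_one (E x)
    linarith
  have hη1' : 0 < 1 - η := by linarith
  have hK0 : (0 : ℝ) < K := lt_of_lt_of_le (by positivity) hKge
  have hKx : (K : ℝ) ≤ η * x := by
    rw [Real.norm_of_nonneg hE0, Real.norm_of_nonneg (by positivity)] at hE2
    refine hKle.trans (hE2.trans ?_)
    gcongr
    exact div_le_self hx0.le (one_le_pow₀ h3)
  have hY : x + 2 + 2 * K ≤ (1 + 3 * η) * x := by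
    rw [div_le_iff₀ hη] at h5
    linarith
  set n := (1 - η) * (x / Real.log x) with hn
  have hn0 : 0 ≤ n := by positivity
  have ha : 1 / (2 * (K : ℝ)) ≤ 1 / (2 * (C * (1 - η))) / Real.log x := by
    rw [div_div]
    refine one_div_le_one_div_of_le (by positivity) ?_
    linarith
  have hb : (1 - η) / (1 + 3 * η) / Real.log x ≤ n / (x + 2 + 2 * K) := by
    calc (1 - η) / (1 + 3 * η) / Real.log x = n / ((1 + 3 * η) * x) := by
          rw [hn]; field_simp
      _ ≤ _ := by gcongr
  have hab : ((1 - η) / (1 + 3 * η) - 1 / (2 * (C * (1 - η)))) / Real.log x ≤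
      n / (x + 2 + 2 * K) - 1 / (2 * K) := by
    rw [sub_div]; linarith
  have hpos : 0 < ((1 - η) / (1 + 3 * η) - 1 / (2 * (C * (1 - η)))) / Real.log x := by positivity
  refine le_trans ?_ (le_sum_primePairCount h4 (Nat.cast_pos.1 hK0) (n := n) (by linarith) hn0
    (by linarith))
  calc (1 - ε) * ((1 - 1 / (2 * C)) * (x / Real.log x ^ 2))
      = (1 - ε) * (1 - 1 / (2 * C)) * (x / Real.log x ^ 2) := by ring
    _ ≤ (1 - η) * ((1 - η) / (1 + 3 * η) - 1 / (2 * (C * (1 - η)))) * (x / Real.log x ^ 2) := by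
        gcongr
    _ = n * (((1 - η) / (1 + 3 * η) - 1 / (2 * (C * (1 - η)))) / Real.log x) := by
        rw [hn, sq]; field_simp
    _ ≤ _ := mul_le_mul_of_nonneg_left hab hn0
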